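/- A structure $\langle \mathbf{L}, F\rangle$ is a distributive lattice $\mathbf{L}$ (not assumed bounded; homomorphisms preserve $\wedge$ and $\vee$) together with a subset $F \subseteq \mathbf{L}$. A strict surjective homomorphism $h\colon \langle \mathbf{L}, F\rangle \to \langle \mathbf{M}, G\rangle$ is a surjective lattice homomorphism $h\colon \mathbf{L}\to\mathbf{M}$ with $F = h^{-1}[G]$; then $\langle \mathbf{M}, G\rangle$ is called a strict homomorphic image of $\langle \mathbf{L}, F\rangle$, and $\langle \mathbf{L}, F\rangle$ a strict homomorphic preimage of $\langle \mathbf{M}, G\rangle$. A substructure of $\langle \mathbf{L}, F\rangle$ is $\langle \mathbf{S}, F \cap \mathbf{S}\rangle$ for a sublattice $\mathbf{S}$ of $\mathbf{L}$, and the product of a family $\langle \mathbf{L}_i, F_i\rangle$ is $\langle \prod_i \mathbf{L}_i, \prod_i F_i\rangle$. A logical class is a class of structures closed under substructures, products, strict homomorphic preimages and strict homomorphic images. For $n \geq 1$ let $\mathbb{B}_n = \langle \mathbf{2}^n, P_n \rangle$, where $\mathbf{2}$ is the two-element lattice and $P_n$ is the set of non-zero elements of $\mathbf{2}^n$. Let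 $\mathsf{DL}_\infty$ be the class of all structures $\langle \mathbf{L}, F\rangle$ in which $F$ is an upset of $\mathbf{L}$. Theorem. $\mathsf{DL}_\infty$ is generated as a logical class by $\{\mathbb{B}_n : n \geq 1\}$: it is a logical class, and it is the smallest logical class that contains all $\mathbb{B}_n$, $n \geq 1$. Moreover, $\mathsf{DL}_\infty$ is defined by the equality-free implications that hold in all $\mathbb{B}_n$: a structure $\langle \mathbf{L}, F\rangle$ belongs to $\mathsf{DL}_\infty$ if and only if, for every set $X$ of variables, every (possibly infinite) set $\Gamma$ of lattice terms over $X$ and every lattice term $\varphi$ over $X$ such that the implication $\Gamma \vdash \varphi$ holds in $\mathbb{B}_n$ for every $n \geq 1$, the implication $\Gamma\vdash\varphi$ holds in $\langle \mathbf{L}, F\rangle$. Here $\Gamma\vdash\varphi$ holds in $\langle \mathbf{L}, F\rangle$ if, for every assignment $e\colon X \to \mathbf{L}$, whenever the value of each $t\in\Gamma$ under $e$ lies in $F$, so does the value of $\varphi$. -/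

import Mathlib

universe u v

/-- A structure `⟨L, F⟩`: a distributive lattice `L` together with an arbitrary subset `F` of `L`. -/
structure DLatStructure : Type (u + 1) where
  carrier : Type u
  [lattice : DistribLattice carrier]
  filter : Set carrier

namespace DLatStructure

attribute [instance] DLatStructure.lattice

/-- `h` is a strict surjective homomorphism `⟨A, F⟩ → ⟨B, G⟩`: a surjective lattice homomorphism
with `F = h⁻¹[G]`. -/
def IsStrictSurjection {A B : DLatStructure.{u}} (h : LatticeHom A.carrier B.carrier) : Prop :=
  Function.Surjective h ∧ A.filter = h ⁻¹' B.filter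

/-- `B` is a strict homomorphic image of `A`, and `A` is a strict homomorphic preimage of `B`. -/
def IsStrictImage (A B : DLatStructure.{u}) : Prop :=
  ∃ h : LatticeHom A.carrier B.carrier, IsStrictSurjection h

/-- The substructure of `⟨A, F⟩` on a sublattice `S`, namely `⟨S, F ∩ S⟩`. -/
def substructure (A : DLatStructure.{u}) (S : Sublattice A.carrier) : DLatStructure.{u} where
  carrier := S
  filter := {x | (x : A.carrier) ∈ A.filter}

/-- The direct product of a family of structures. -/
def product {I : Type u} (A : I → DLatStructure.{u}) : DLatStructure.{u} where
  carrier := ∀ i, (A i).carrier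
  filter := {x | ∀ i, x i ∈ (A i).filter}

/-- A logical class of structures over distributive lattices. -/
structure IsLogicalClass (K : Set DLatStructure.{u}) : Prop where
  substructure_mem : ∀ A ∈ K, ∀ S : Sublattice A.carrier, A.substructure S ∈ K
  product_mem : ∀ (I : Type u) (A : I → DLatStructure.{u}), (∀ i, A i ∈ K) → product A ∈ K
  preimage_mem : ∀ A B : DLatStructure.{u}, IsStrictImage A B → B ∈ K → A ∈ K
  image_mem : ∀ A B : DLatStructure.{u}, IsStrictImage A B → A ∈ K → B ∈ K

/-- The logical class generated by `G`: the intersection of all logical classes containing `G`. -/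
def logicalClassGenerated (G : Set DLatStructure.{u}) : Set DLatStructure.{u} :=
  ⋂₀ {K | IsLogicalClass K ∧ G ⊆ K}

/-- The structure `⟨2ⁿ, Pₙ⟩`: the `n`-th power of the two-element lattice with its set of non-zero
elements. (The index set is lifted so that the structure lives in the universe at hand.) -/
def boolPow (n : ℕ) : DLatStructure.{u} where
  carrier := ULift.{u} (Fin n) → Bool
  filter := {x | x ≠ ⊥}

/-- The class of all distributive lattices equipped with an upset. -/
def upsetClass : Set DLatStructure.{u} :=
  {A | IsUpperSet A.filter}

/-- Lattice terms over a set `X` of variables. -/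
inductive LatTerm (X : Type v) : Type v
  | var : X → LatTerm X
  | meet : LatTerm X → LatTerm X → LatTerm X
  | join : LatTerm X → LatTerm X → LatTerm X

/-- The value of a lattice term under an assignment of its variables. -/
def LatTerm.eval {X : Type v} {L : Type u} [DistribLattice L] (e : X → L) : LatTerm X → L
  | .var x => e x
  | .meet s t => s.eval e ⊓ t.eval e
  | .join s t => s.eval e ⊔ t.eval e

/-- The structure `A` satisfies the (possibly infinitary) equality-free implication
`F(t)` for all `t ∈ Γ` implies `F(φ)`. -/
def Satisfies (A : DLatStructure.{u}) {X : Type v} (Γ : Set (LatTerm X)) (φ : LatTerm X) : Prop :=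
  ∀ e : X → A.carrier, (∀ t ∈ Γ, t.eval e ∈ A.filter) → φ.eval e ∈ A.filter

end DLatStructure

/-! Finitely many Boolean valuations, the maximal ones included, suffice to test refutation of a
term `φ`, even over infinitely many variables: if all of them refute `t`, then `t ≤ φ` in every
distributive lattice (`eval_le_eval_of_refuting`). Read as coordinates, they give an assignment into
some `boolPow n` that sends `φ` to zero. If the filter of `A` is an upset and `A` accepts `t` but
not `φ`, then `t ≤ φ` fails, so `t` becomes non-zero. This countermodel depends on `φ` alone, so it
serves infinite `Γ`. Multiplying the countermodels of all terms rejected by `A` gives an assignment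
accepting exactly the terms that `A` accepts; `mem_of_forall_eval_mem_iff` then brings `A` into the
class. -/

namespace DLatStructure

namespace LatTerm

variable {X : Type v}

/-- A finite list of valuations among which are the largest Boolean valuations refuting a term. -/
noncomputable def refuting (φ : LatTerm X) : List (X → Bool) :=
  open Classical in
  match φ with
  | var x => [fun y => decide (y ≠ x)]
  | meet s t => s.refuting ++ t.refuting
  | join s t => s.refuting.flatMap fun v => t.refuting.map fun w => v ⊓ w

theorem refuting_ne_nil (φ : LatTerm X) : φ.refuting ≠ [] := by
  induction φ with
  | var x => simp [refuting]
  | meet s t hs ht => simp [refuting, hs]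
  | join s t hs ht =>
    obtain ⟨v, hv⟩ := List.exists_mem_of_ne_nil _ hs
    obtain ⟨w, hw⟩ := List.exists_mem_of_ne_nil _ ht
    exact List.ne_nil_of_mem (a := v ⊓ w)
      (List.mem_flatMap.2 ⟨v, hv, List.mem_map.2 ⟨w, hw, rfl⟩⟩)

theorem eval_mono {L : Type u} [DistribLattice L] {e e' : X → L} (h : e ≤ e') (t : LatTerm X) :
    t.eval e ≤ t.eval e' := by
  induction t with
  | var x => exact h x
  | meet s t hs ht => exact inf_le_inf hs ht
  | join s t hs ht => exact sup_le_sup hs ht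

theorem eval_eq_false_of_mem_refuting {φ : LatTerm X} {v : X → Bool} (hv : v ∈ φ.refuting) :
    φ.eval v = false := by
  induction φ generalizing v with
  | var x =>
    obtain rfl := List.mem_singleton.1 hv
    simp [eval]
  | meet s t hs ht =>
    rcases List.mem_append.1 hv with h | h
    · simp [eval, hs h]
    · simp [eval, ht h]
  | join s t hs ht =>
    obtain ⟨v, hs', hm⟩ := List.mem_flatMap.1 hv
    obtain ⟨w, ht', rfl⟩ := List.mem_map.1 hm
    have h1 : s.eval (v ⊓ w) ≤ false := (eval_mono inf_le_left s).trans_eq (hs hs')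
    have h2 : t.eval (v ⊓ w) ≤ false := (eval_mono inf_le_right t).trans_eq (ht ht')
    exact le_bot_iff.1 (sup_le h1 h2)

theorem eval_le_of_eval_eq_false {L : Type u} [DistribLattice L] {e : X → L} {v : X → Bool} {a : L}
    (ha : ∀ x, v x = false → e x ≤ a) {t : LatTerm X} (ht : t.eval v = false) : t.eval e ≤ a := by
  induction t with
  | var x => exact ha x ht
  | meet s t hs ht' =>
    rcases Bool.and_eq_false_iff.1 ht with h | h
    · exact inf_le_left.trans (hs h)
    · exact inf_le_right.trans (ht' h)
  | join s t hs ht' =>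
    obtain ⟨h1, h2⟩ := Bool.or_eq_false_iff.1 ht
    exact sup_le (hs h1) (ht' h2)

/-- The parameter `c` carries the induction through joins: the bound `a` obtained while treating one
joinand becomes the `c` of the other. -/
theorem le_eval_sup {L : Type u} [DistribLattice L] {e : X → L} (φ : LatTerm X) {b c : L}
    (h : ∀ v ∈ φ.refuting, ∀ a, c ≤ a → (∀ x, v x = false → e x ≤ a) → b ≤ a) :
    b ≤ φ.eval e ⊔ c := by
  induction φ generalizing c with
  | var x =>
    refine h _ (List.mem_singleton.2 rfl) _ le_sup_right fun y hy => ?_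
    obtain rfl : y = x := by simpa using hy
    exact le_sup_left
  | meet s t hs ht =>
    rw [eval, sup_inf_right]
    exact le_inf (hs fun v hv => h v (List.mem_append_left _ hv))
      (ht fun v hv => h v (List.mem_append_right _ hv))
  | join s t hs ht =>
    rw [eval, sup_assoc]
    refine hs fun v hv a hca hva => ?_
    have hle : b ≤ t.eval e ⊔ a := ht fun w hw a' haa' hwa' =>
      h (v ⊓ w) (List.mem_flatMap.2 ⟨v, hv, List.mem_map.2 ⟨w, hw, rfl⟩⟩) a'
        ((le_sup_right.trans hca).trans haa') fun x hx =>
          (Bool.and_eq_false_iff.1 hx).elim (fun h => (hva x h).trans haa') (hwa' x)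
    exact hle.trans (sup_le (le_sup_left.trans hca) le_rfl)

/-- An inequality between lattice terms holds in every distributive lattice as soon as the left-hand
side is refuted by the finitely many valuations in `φ.refuting`. -/
theorem eval_le_eval_of_refuting {L : Type u} [DistribLattice L] (e : X → L) {t φ : LatTerm X}
    (h : ∀ v ∈ φ.refuting, t.eval v = false) : t.eval e ≤ φ.eval e := by
  simpa using le_eval_sup (e := e) φ (c := φ.eval e)
    fun v hv a _ hva => eval_le_of_eval_eq_false hva (h v hv)

/-- The assignment into a finite Boolean power whose coordinates are the valuations in
`φ.refuting`. -/
noncomputable def countermodel (φ : LatTerm X) : X → (boolPow.{u} φ.refuting.length).carrier :=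
  fun x i => φ.refuting.get i.down x

theorem eval_boolPow_apply {n : ℕ} (e : X → (boolPow.{u} n).carrier) (i : ULift.{u} (Fin n))
    (t : LatTerm X) : t.eval e i = t.eval fun x => e x i := by
  induction t with
  | var x => rfl
  | meet s t hs ht => exact congrArg₂ (· ⊓ ·) hs ht
  | join s t hs ht => exact congrArg₂ (· ⊔ ·) hs ht

theorem eval_product_apply {I : Type u} {A : I → DLatStructure.{u}} (e : X → (product A).carrier)
    (i : I) (t : LatTerm X) : t.eval e i = t.eval fun x => e x i := by
  induction t with
  | var x => rfl
  | meet s t hs ht => exact congrArg₂ (· ⊓ ·) hs ht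
  | join s t hs ht => exact congrArg₂ (· ⊔ ·) hs ht

theorem eval_mem_product_filter {I : Type u} {A : I → DLatStructure.{u}}
    (e : X → (product A).carrier) (t : LatTerm X) :
    t.eval e ∈ (product A).filter ↔ ∀ i, t.eval (fun x => e x i) ∈ (A i).filter :=
  forall_congr' fun i => by rw [eval_product_apply]

theorem eval_countermodel_not_mem_filter (φ : LatTerm X) :
    φ.eval φ.countermodel ∉ (boolPow.{u} φ.refuting.length).filter := by
  refine not_not_intro (funext fun i => ?_)
  rw [eval_boolPow_apply]
  exact eval_eq_false_of_mem_refuting (List.get_mem _ i.down)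

theorem eval_countermodel_mem_filter {A : DLatStructure.{u}} (hA : IsUpperSet A.filter)
    {e : X → A.carrier} {t φ : LatTerm X} (ht : t.eval e ∈ A.filter) (hφ : φ.eval e ∉ A.filter) :
    t.eval φ.countermodel ∈ (boolPow.{u} φ.refuting.length).filter := by
  intro h
  refine hφ (hA (eval_le_eval_of_refuting e fun v hv => ?_) ht)
  obtain ⟨i, rfl⟩ := List.get_of_mem hv
  exact (eval_boolPow_apply φ.countermodel ⟨i⟩ t).symm.trans (congrFun h ⟨i⟩)

/-- The sublattice of values of terms under a given assignment. -/
def valueSublattice {L : Type u} [DistribLattice L] (e : X → L) : Sublattice L where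
  carrier := Set.range fun t : LatTerm X => t.eval e
  supClosed' := by
    rintro _ ⟨s, rfl⟩ _ ⟨t, rfl⟩
    exact ⟨s.join t, rfl⟩
  infClosed' := by
    rintro _ ⟨s, rfl⟩ _ ⟨t, rfl⟩
    exact ⟨s.meet t, rfl⟩

theorem eval_prod {L M : Type u} [DistribLattice L] [DistribLattice M] (e : X → L) (f : X → M)
    (t : LatTerm X) : t.eval (fun x => (e x, f x)) = (t.eval e, t.eval f) := by
  induction t with
  | var x => rfl
  | meet s t hs ht => rw [eval, hs, ht]; rfl
  | join s t hs ht => rw [eval, hs, ht]; rfl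

end LatTerm

theorem isUpperSet_boolPow_filter (n : ℕ) : IsUpperSet (boolPow.{u} n).filter :=
  fun _ _ hab ha hb => ha (le_bot_iff.1 (hab.trans_eq hb))

theorem isLogicalClass_upsetClass : IsLogicalClass upsetClass.{u} where
  substructure_mem _ hA _ _ _ hab ha := hA hab ha
  product_mem _ _ hA _ _ hab ha i := hA i (hab i) (ha i)
  preimage_mem := by
    rintro A B ⟨h, -, hF⟩ hB
    change IsUpperSet A.filter
    rw [hF]
    exact fun a b hab ha => hB (OrderHomClass.mono h hab) ha
  image_mem := by
    rintro A B ⟨h, hs, hF⟩ hA a b hab ha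
    obtain ⟨x, rfl⟩ := hs a
    obtain ⟨y, rfl⟩ := hs b
    have hx : x ∈ A.filter := hF ▸ ha
    -- `y` need not lie above `x`, but `x ⊔ y` does and has the same image, since `h x ≤ h y`.
    have hxy : x ⊔ y ∈ h ⁻¹' B.filter := hF ▸ hA le_sup_left hx
    simpa [sup_eq_right.2 hab] using hxy

/-- If an assignment into `B` takes exactly the same terms into the filter as some assignment onto
`A`, then `A` belongs to every logical class containing `B`. -/
theorem IsLogicalClass.mem_of_forall_eval_mem_iff {K : Set DLatStructure.{u}}
    (hK : IsLogicalClass K) {A B : DLatStructure.{u}} (hB : B ∈ K) {X : Type v}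
    (e : X → A.carrier) (he : Function.Surjective e) (f : X → B.carrier)
    (h : ∀ t : LatTerm X, t.eval e ∈ A.filter ↔ t.eval f ∈ B.filter) : A ∈ K := by
  let S := LatTerm.valueSublattice fun x => (e x, f x)
  -- `S` is generated by the pairs `(e x, f x)`. By `h`, pulling back either filter along its
  -- projection gives the filter of `D`.
  let D : DLatStructure.{u} := { carrier := S, filter := {p | p.1.1 ∈ A.filter} }
  let T := LatTerm.valueSublattice f
  have hS : ∀ p ∈ S, ∃ t : LatTerm X, p = (t.eval e, t.eval f) := by
    rintro _ ⟨t, rfl⟩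
    exact ⟨t, LatTerm.eval_prod e f t⟩
  let g : LatticeHom D.carrier (B.substructure T).carrier :=
    { toFun := fun p => ⟨p.1.2, by
        obtain ⟨t, ht⟩ := hS p.1 p.2
        exact ⟨t, by rw [ht]⟩⟩
      map_sup' := fun _ _ => rfl
      map_inf' := fun _ _ => rfl }
  let k : LatticeHom D.carrier A.carrier :=
    { toFun := fun p => p.1.1
      map_sup' := fun _ _ => rfl
      map_inf' := fun _ _ => rfl }
  have hg : IsStrictSurjection g := by
    refine ⟨?_, ?_⟩
    · rintro ⟨_, t, rfl⟩
      exact ⟨⟨_, t, rfl⟩, Subtype.ext (congrArg Prod.snd (LatTerm.eval_prod e f t))⟩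
    · ext ⟨p, hp⟩
      obtain ⟨t, rfl⟩ := hS p hp
      exact h t
  have hk : IsStrictSurjection k := by
    refine ⟨fun a => ?_, rfl⟩
    obtain ⟨x, rfl⟩ := he a
    exact ⟨⟨(e x, f x), .var x, rfl⟩, rfl⟩
  exact hK.image_mem D A ⟨k, hk⟩
    (hK.preimage_mem D _ ⟨g, hg⟩ (hK.substructure_mem B hB T))

theorem IsLogicalClass.upsetClass_subset {K : Set DLatStructure.{u}} (hK : IsLogicalClass K)
    (hB : ∀ n : ℕ, 1 ≤ n → boolPow.{u} n ∈ K) : upsetClass.{u} ⊆ K := by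
  intro A hA
  -- Every element of `A` is its own variable, so `id` is a surjective assignment.
  let I := {φ : LatTerm A.carrier // φ.eval id ∉ A.filter}
  have hP : product (fun φ : I => boolPow.{u} φ.1.refuting.length) ∈ K :=
    hK.product_mem _ _ fun φ => hB _ (List.length_pos_of_ne_nil φ.1.refuting_ne_nil)
  refine hK.mem_of_forall_eval_mem_iff hP id Function.surjective_id
    (fun x φ => φ.1.countermodel x) fun t => Iff.trans ⟨fun ht φ => ?_, fun ht => ?_⟩
      (LatTerm.eval_mem_product_filter _ t).symm
  · exact LatTerm.eval_countermodel_mem_filter hA ht φ.2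
  -- A rejected term `t` is itself an index, and its own coordinate sends it to zero.
  · by_contra hn
    exact t.eval_countermodel_not_mem_filter (ht ⟨t, hn⟩)

theorem upsetClass_eq_logicalClassGenerated :
    upsetClass.{u} = logicalClassGenerated {A | ∃ n : ℕ, 1 ≤ n ∧ A = boolPow.{u} n} := by
  refine Set.Subset.antisymm (Set.subset_sInter ?_) (Set.sInter_subset_of_mem
    ⟨isLogicalClass_upsetClass, ?_⟩)
  · rintro K ⟨hK, hG⟩
    exact hK.upsetClass_subset fun n hn => hG ⟨n, hn, rfl⟩
  · rintro _ ⟨n, -, rfl⟩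
    exact isUpperSet_boolPow_filter n

theorem Satisfies.of_forall_boolPow {A : DLatStructure.{u}} (hA : IsUpperSet A.filter)
    {X : Type v} {Γ : Set (LatTerm X)} {φ : LatTerm X}
    (h : ∀ n : ℕ, 1 ≤ n → (boolPow.{u} n).Satisfies Γ φ) : A.Satisfies Γ φ := by
  intro e he
  by_contra hφ
  exact φ.eval_countermodel_not_mem_filter
    (h _ (List.length_pos_of_ne_nil φ.refuting_ne_nil) φ.countermodel
      fun t ht => LatTerm.eval_countermodel_mem_filter hA (he t ht) hφ)

/-- For `a ≤ b` the premise takes the value `a ⊓ b = a`. -/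
theorem isUpperSet_filter_iff_satisfies {A : DLatStructure.{u}} {X : Type v} {x y : X}
    (hxy : x ≠ y) :
    IsUpperSet A.filter ↔ A.Satisfies {(LatTerm.var x).meet (.var y)} (.var y) := by
  classical
  refine ⟨fun hA e he => hA inf_le_right (he _ rfl), fun h a b hab ha => ?_⟩
  have := h (fun z => if z = x then a else b) (by
    rintro _ rfl
    simpa [LatTerm.eval, hxy.symm, inf_eq_left.2 hab] using ha)
  simpa [LatTerm.eval, hxy.symm] using this

end DLatStructure

theorem mainTheorem7 :
    DLatStructure.IsLogicalClass DLatStructure.upsetClass.{u} ∧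
    DLatStructure.upsetClass.{u} =
      DLatStructure.logicalClassGenerated {A | ∃ n : ℕ, 1 ≤ n ∧ A = DLatStructure.boolPow.{u} n} ∧
    ∀ A : DLatStructure.{u}, A ∈ DLatStructure.upsetClass.{u} ↔
      ∀ (X : Type v) (Γ : Set (DLatStructure.LatTerm X)) (φ : DLatStructure.LatTerm X),
        (∀ n : ℕ, 1 ≤ n → (DLatStructure.boolPow.{u} n).Satisfies Γ φ) → A.Satisfies Γ φ := by
  refine ⟨DLatStructure.isLogicalClass_upsetClass,
    DLatStructure.upsetClass_eq_logicalClassGenerated, fun A =>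
    ⟨fun hA X Γ φ h => DLatStructure.Satisfies.of_forall_boolPow hA h, fun h => ?_⟩⟩
  have hne : (⟨true⟩ : ULift.{v} Bool) ≠ ⟨false⟩ := by simp
  exact (DLatStructure.isUpperSet_filter_iff_satisfies hne).2 (h _ _ _ fun n _ =>
    (DLatStructure.isUpperSet_filter_iff_satisfies hne).1 (DLatStructure.isUpperSet_boolPow_filter n))
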